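/- Let $\mathbf{K}$ be an abstract elementary class with a monster model $\mathfrak{C}$: $\mathfrak C\in\mathbf K$, the cardinal $\|\mathfrak{C}\|$ is strongly inaccessible and larger than $\operatorname{LS}(\mathbf{K})$, and $\mathfrak{C}$ is $\|\mathfrak{C}\|$-universal and $\|\mathfrak{C}\|$-model homogeneous. (Such a monster model is the usual way of working with an AEC with joint embedding, amalgamation and no maximal models.) "Small" means of size $<\|\mathfrak{C}\|$; all models $M, N, \dots$ below are small with $M\le_{\mathbf{K}}\mathfrak{C}$; all sets are small subsets of $\mathfrak{C}$; all cardinals $\theta,\lambda,\mu$ are $<\|\mathfrak C\|$; and $[\operatorname{LS}(\mathbf{K}),\infty)$ stands for $[\operatorname{LS}(\mathbf{K}),\|\mathfrak{C}\|)$. $\mathbf{tp}(\mathbf b/A)$ is the Galois type in $\mathfrak{C}$ of a small nonempty sequence $\mathbf b$ over $A$. A relation $A \perp_M B$ between a model $M$ and sets $A,B$ is an *independence relation* if it is invariant under $\operatorname{Aut}(\mathfrak{C})$ and satisfies, where "$\mathbf{tp}(\mathbf b/B)$ does not fork over $M$" means $\operatorname{ran}(\mathbf b)\perp_M B$: - monotonicity: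 if $A\perp_M B$, $A_0\subseteq A$ and $B_0\subseteq B$, then $A_0\perp_M B_0$; - normality: $A\perp_M B$ iff $A\cup M\perp_M B\cup M$; - base monotonicity: if $A\perp_M B$, $M\le_{\mathbf K} N$ and $N\subseteq B$, then $A\perp_N B$; - existence: if $M\le_{\mathbf K}N$, every type over $M$ extends to a type over $N$ that does not fork over $M$; - transitivity: if $M\le_{\mathbf K}N$, $A\perp_M N$ and $A\perp_N B$, then $A\perp_M B$. It is *simple* if moreover it satisfies: - symmetry: $A\perp_M B$ iff $B\perp_M A$; - type-amalgamation: if $M\subseteq A,B\subseteq N$, $A\perp_M B$, and $q_1,q_2$ are types over $A,B$ respectively that extend the same type over $M$ and do not fork over $M$, then some type over $N$ extends both $q_1$ and $q_2$ and does not fork over $M$; - uniform local character: there are cardinals $\theta,\lambda$ such that every type over $M$ of a sequence of length $\alpha$ does not fork over some $M_0\le_{\mathbf K}M$ with $\|M_0\|\le\lambda+\alpha^{<\theta}$. It has the *$(<\aleph_0)$-witness property for singletons* if for all $M\le_{\mathbf K}N$ and $b\in\mathfrak{C}$: $b\perp_M N$ iff $b\perp_M A$ for every finite $A\subseteq N$.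 For $\mu,\lambda\in[\operatorname{LS}(\mathbf{K}),\infty)$ and $k<\omega$, $\mathbf{K}$ has the *$(\mu,\lambda,k)$-tree property* if there are $a_\eta\in\mathfrak{C}$ and $B_\eta\subseteq\mathfrak{C}$, for $\eta\in{}^{<\mu}\lambda$, such that: (1) $|B_\eta|<\operatorname{LS}(\mathbf{K})$ for all $\eta\in{}^{<\mu}\lambda$; (2) for every $\nu\in{}^{\mu}\lambda$ some element of $\mathfrak{C}$ realizes $\mathbf{tp}(a_{\nu\restriction\beta}/B_{\nu\restriction\beta})$ for all $\beta<\mu$; (3) for every $\eta\in{}^{<\mu}\lambda$ and every set $s\subseteq\lambda$ of exactly $k$ indices, no element of $\mathfrak{C}$ realizes $\mathbf{tp}(a_{\eta^\frown\alpha}/B_{\eta^\frown\alpha})$ for all $\alpha\in s$. $\mathbf{K}$ has the *$k$-tree property* if it has the $(\mu,\lambda,k)$-tree property for all $\mu,\lambda\in[\operatorname{LS}(\mathbf{K}),\infty)$, and the *tree property* if it has the $k$-tree property for some $k<\omega$. **Theorem.** If $\mathbf{K}$ has a simple independence relation with the $(<\aleph_0)$-witness property for singletons, then $\mathbf{K}$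 does not have the tree property. -/

import Mathlib

open Cardinal
open scoped FirstOrder

universe w

/-- For substructures `S ≤ T` of `N`: the substructure `S`, viewed as a substructure of `T`. -/
def FirstOrder.Language.Substructure.within {L : FirstOrder.Language.{w, w}} {N : Type w} [L.Structure N]
    (S T : L.Substructure N) : L.Substructure T :=
  S.comap T.subtype.toHom

/-- `lam` is a Löwenheim–Skolem bound for the relation `Strong N S` (read: `S ≤_K N`). -/
def IsLSBound {L : FirstOrder.Language.{w, w}} (Mem : ∀ (M : Type w) [L.Structure M], Prop)
    (Strong : ∀ (N : Type w) [L.Structure N], L.Substructure N → Prop) (lam : Cardinal.{w}) : Prop :=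
  ℵ₀ ≤ lam ∧ L.card ≤ lam ∧
    ∀ (N : Type w) [L.Structure N], Mem N → ∀ A : Set N,
      ∃ S : L.Substructure N, Strong N S ∧ A ⊆ (S : Set N) ∧ #S ≤ #A + lam

/-- An abstract elementary class of `L`-structures. `Mem M` says that `M` belongs to the class
`K`, and `Strong N S` says that `S` is a `K`-submodel of `N`, i.e. `S ≤_K N`. -/
structure AEC (L : FirstOrder.Language.{w, w}) where
  Mem : ∀ (M : Type w) [L.Structure M], Prop
  Strong : ∀ (N : Type w) [L.Structure N], L.Substructure N → Prop
  /-- `≤_K` is a relation between members of `K`. -/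
  mem_of_strong : ∀ {N : Type w} [L.Structure N] {S : L.Substructure N},
    Strong N S → Mem S ∧ Mem N
  /-- Closure of `K` under isomorphisms. -/
  mem_of_equiv : ∀ {M N : Type w} [L.Structure M] [L.Structure N],
    (M ≃[L] N) → Mem M → Mem N
  /-- Closure of `≤_K` under isomorphisms. -/
  strong_of_equiv : ∀ {M N : Type w} [L.Structure M] [L.Structure N] (e : M ≃[L] N)
    {S : L.Substructure M}, Strong M S → Strong N (S.map e.toHom)
  /-- Reflexivity of `≤_K`. -/
  strong_refl : ∀ {N : Type w} [L.Structure N], Mem N → Strong N ⊤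
  /-- Transitivity of `≤_K`. -/
  strong_trans : ∀ {N : Type w} [L.Structure N] {S T : L.Substructure N}, S ≤ T →
    Strong T (S.within T) → Strong N T → Strong N S
  /-- Coherence. -/
  coherence : ∀ {N : Type w} [L.Structure N] {S T : L.Substructure N}, S ≤ T →
    Strong N S → Strong N T → Strong T (S.within T)
  /-- The union `N` of a `≤_K`-increasing chain belongs to `K` and lies `≤_K`-above the chain. -/
  strong_of_union : ∀ {N : Type w} [L.Structure N] {ι : Type w} [LinearOrder ι] [WellFoundedLT ι]
    [Nonempty ι] (S : ι → L.Substructure N),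
    (∀ i j, i ≤ j → S i ≤ S j ∧ Strong (S j) ((S i).within (S j))) →
    (∀ x : N, ∃ i, x ∈ S i) → Mem N ∧ ∀ i, Strong N (S i)
  /-- If all members of an increasing chain are `≤_K N`, then so is their union `T`. -/
  union_strong : ∀ {N : Type w} [L.Structure N] {ι : Type w} [LinearOrder ι] [WellFoundedLT ι]
    [Nonempty ι] (S : ι → L.Substructure N), Monotone S → (∀ i, Strong N (S i)) →
    ∀ T : L.Substructure N, (T : Set N) = ⋃ i, (S i : Set N) → Strong N T
  /-- The Löwenheim–Skolem–Tarski axiom. -/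
  exists_isLSBound : ∃ lam : Cardinal.{w}, IsLSBound Mem Strong lam

namespace AEC

variable {L : FirstOrder.Language.{w, w}}

/-- The Löwenheim–Skolem number `LS(K)`: the least Löwenheim–Skolem bound. -/
noncomputable def LS (K : AEC L) : Cardinal.{w} :=
  sInf {lam | IsLSBound K.Mem K.Strong lam}

/-- `f` is a `K`-embedding: an isomorphism onto a `K`-submodel of `N`. -/
def IsKEmb (K : AEC L) {M N : Type w} [L.Structure M] [L.Structure N] (f : M ↪[L] N) : Prop :=
  K.Strong N f.toHom.range

/-- `M` is `lam`-universal. -/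
def IsUniversal (K : AEC L) (lam : Cardinal.{w}) (M : Type w) [L.Structure M] : Prop :=
  ∀ (N : Type w) [L.Structure N], K.Mem N → #N < lam → ∃ f : N ↪[L] M, K.IsKEmb f

/-- `M` is `lam`-model homogeneous: if `M₀ ≤_K N₀` (via `i`) have size `< lam` and `M₀ ≤_K M`
(via `j`), then there is a `K`-embedding of `N₀` into `M` over `M₀`. -/
def IsModelHomogeneous (K : AEC L) (lam : Cardinal.{w}) (M : Type w) [L.Structure M] : Prop :=
  ∀ (M₀ N₀ : Type w) [L.Structure M₀] [L.Structure N₀] (i : M₀ ↪[L] N₀) (j : M₀ ↪[L] M),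
    #M₀ < lam → #N₀ < lam → K.IsKEmb i → K.IsKEmb j →
    ∃ f : N₀ ↪[L] M, K.IsKEmb f ∧ ∀ x, f (i x) = j x

/-- `C` is a monster model of `K`. Its cardinality plays the role of `∞`: "small" means of
cardinality less than `#C`. (A monster model the size of the class of all sets of a universe `u` is
the case `w = u + 1`, `#C = univ.{u, u + 1}`.) -/
structure IsMonster (K : AEC L) (C : Type w) [L.Structure C] : Prop where
  mem : K.Mem C
  inaccessible : (#C).IsInaccessible
  LS_lt : K.LS < #C
  universal : K.IsUniversal (#C) C
  homogeneous : K.IsModelHomogeneous (#C) C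

section Monster

variable (K : AEC L) {C : Type w} [L.Structure C]

/-- `M` is a small model inside the monster model: `M ≤_K C` and `‖M‖ < ‖C‖`. For two such `M`, `N`
one has `M ≤_K N` if and only if `M ≤ N` as substructures, by coherence and transitivity. -/
def SmallModel (M : L.Substructure C) : Prop :=
  K.Strong C M ∧ #M < #C

/-- `tp(b₁/A; C) = tp(b₂/A; C)`, equality of Galois types: there are `K`-embeddings of `C` into
some member of `K` which agree on `A` and send `b₁` and `b₂` to the same sequence. -/
def TpEq {I : Type w} (A : Set C) (b₁ b₂ : I → C) : Prop :=
  ∃ (N : Type w) (_ : L.Structure N) (f₁ f₂ : C ↪[L] N), K.IsKEmb f₁ ∧ K.IsKEmb f₂ ∧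
    (∀ a ∈ A, f₁ a = f₂ a) ∧ ∀ i, f₁ (b₁ i) = f₂ (b₂ i)

/-- The element `c` realizes the Galois type `tp(a/B; C)`. -/
def Realizes (c a : C) (B : Set C) : Prop :=
  K.TpEq B (fun _ : PUnit.{w + 1} => c) (fun _ : PUnit.{w + 1} => a)

/-- `D` is an independence relation in `K`; `D M A B` is read "`A` is independent from `B` over `M`",
and `tp(b/B)` does not fork over `M` if `D M (ran b) B`. All sets and models are small. -/
structure IsIndependence (D : L.Substructure C → Set C → Set C → Prop) : Prop where
  /-- Preservation under automorphisms of the monster model. -/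
  invariance : ∀ (M : L.Substructure C) (A B : Set C) (f : C ≃[L] C), K.SmallModel M →
    #A < #C → #B < #C → (D M A B ↔ D (M.map f.toHom) (f '' A) (f '' B))
  monotonicity : ∀ (M : L.Substructure C) (A B A₀ B₀ : Set C), K.SmallModel M →
    #A < #C → #B < #C → A₀ ⊆ A → B₀ ⊆ B → D M A B → D M A₀ B₀
  normality : ∀ (M : L.Substructure C) (A B : Set C), K.SmallModel M →
    #A < #C → #B < #C → (D M A B ↔ D M (A ∪ M) (B ∪ M))
  baseMonotonicity : ∀ (M N : L.Substructure C) (A B : Set C), K.SmallModel M → K.SmallModel N →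
    #A < #C → #B < #C → M ≤ N → (N : Set C) ⊆ B → D M A B → D N A B
  existence : ∀ (M N : L.Substructure C), K.SmallModel M → K.SmallModel N → M ≤ N →
    ∀ (I : Type w) [Nonempty I] (b : I → C), #I < #C →
      ∃ c : I → C, K.TpEq (M : Set C) c b ∧ D M (Set.range c) N
  transitivity : ∀ (M N : L.Substructure C) (A B : Set C), K.SmallModel M → K.SmallModel N →
    #A < #C → #B < #C → M ≤ N → D M A N → D N A B → D M A B

/-- `D` is a simple independence relation in `K`. -/
structure IsSimpleIndependence (D : L.Substructure C → Set C → Set C → Prop) : Prop extends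
    K.IsIndependence D where
  symmetry : ∀ (M : L.Substructure C) (A B : Set C), K.SmallModel M →
    #A < #C → #B < #C → (D M A B ↔ D M B A)
  /-- Two nonforking extensions `tp(b₁/A)`, `tp(b₂/B)` of the same type over `M`, where `A` and `B`
  are independent over `M`, have a common nonforking extension to any model `N ⊇ A, B`. -/
  typeAmalgamation : ∀ (M N : L.Substructure C) (A B : Set C), K.SmallModel M → K.SmallModel N →
    (M : Set C) ⊆ A → (M : Set C) ⊆ B → A ⊆ N → B ⊆ N → D M A B →
    ∀ (I : Type w) [Nonempty I] (b₁ b₂ : I → C), #I < #C → K.TpEq (M : Set C) b₁ b₂ →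
      D M (Set.range b₁) A → D M (Set.range b₂) B →
      ∃ c : I → C, K.TpEq A c b₁ ∧ K.TpEq B c b₂ ∧ D M (Set.range c) N
  uniformLocalCharacter : ∃ θ lam : Cardinal.{w}, θ < #C ∧ lam < #C ∧
    ∀ M : L.Substructure C, K.SmallModel M →
      ∀ (I : Type w) [Nonempty I] (b : I → C), #I < #C →
        ∃ M₀ : L.Substructure C, K.SmallModel M₀ ∧ M₀ ≤ M ∧ #M₀ ≤ lam + #I ^< θ ∧
          D M₀ (Set.range b) M

/-- The `(<θ)`-witness property of length `α`. -/
def WitnessProperty (D : L.Substructure C → Set C → Set C → Prop) (θ α : Cardinal.{w}) : Prop :=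
  ∀ M N : L.Substructure C, K.SmallModel M → K.SmallModel N → M ≤ N →
    ∀ (I : Type w) (b : I → C), #I = α →
      (D M (Set.range b) N ↔
        ∀ A : Set C, A ⊆ N → #A < θ → D M (Set.range b) A)

/-- The sequence `η⌢x` of length `β + 1`. -/
noncomputable def snoc {Λ : Type*} {β : Ordinal.{w}} (η : Set.Iio β → Λ) (x : Λ) :
    Set.Iio (Order.succ β) → Λ :=
  open Classical in fun i => if h : i.1 < β then η ⟨i.1, h⟩ else x

/-- The restriction `ν ↾ β` of a sequence of length `γ ≥ β`. -/
def restr {Λ : Type*} {γ : Ordinal.{w}} (ν : Set.Iio γ → Λ) (β : Ordinal.{w}) (h : β ≤ γ) :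
    Set.Iio β → Λ :=
  fun i => ν ⟨i.1, lt_of_lt_of_le i.2 h⟩

variable (C)

/-- The `(μ, lam, k)`-tree property of `K`, in the monster model `C`. Only the values `a β η`,
`B β η` for `β < μ` matter. -/
def HasTreePropertyAt (μ lam : Cardinal.{w}) (k : ℕ) : Prop :=
  ∃ (a : ∀ β : Ordinal.{w}, (Set.Iio β → Set.Iio lam.ord) → C)
    (B : ∀ β : Ordinal.{w}, (Set.Iio β → Set.Iio lam.ord) → Set C),
    (∀ β < μ.ord, ∀ η, #(B β η) < K.LS) ∧
    (∀ ν : Set.Iio μ.ord → Set.Iio lam.ord, ∃ c : C, ∀ (β : Ordinal.{w}) (h : β < μ.ord),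
      K.Realizes c (a β (restr ν β h.le)) (B β (restr ν β h.le))) ∧
    (∀ β < μ.ord, ∀ (η : Set.Iio β → Set.Iio lam.ord) (s : Finset (Set.Iio lam.ord)),
      s.card = k → ¬ ∃ c : C, ∀ x ∈ s,
        K.Realizes c (a (Order.succ β) (snoc η x)) (B (Order.succ β) (snoc η x)))

/-- The `k`-tree property. -/
def HasKTreeProperty (k : ℕ) : Prop :=
  ∀ μ lam : Cardinal.{w}, K.LS ≤ μ → μ < #C → K.LS ≤ lam → lam < #C →
    K.HasTreePropertyAt C μ lam k

/-- The tree property. -/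
def HasTreeProperty : Prop :=
  ∃ k : ℕ, K.HasKTreeProperty C k

end Monster

end AEC

/-! Local character gives a regular cardinal `δ > LS(K)` such that the type over a model of a
sequence of length at most `LS(K)` does not fork over a submodel of size below `δ`. Let `κ = ℶ_δ`,
`μ = κ⁺`, `Λ = ℶ_μ`, and suppose that a `(μ, Λ, k)`-tree exists. As `Λ` is a strong limit of
cofinality `μ`, the tree has at most `Λ` nodes, so its parameters lie in a model `M` of size at most
`Λ`. Every branch `ν` has a realization `c ν`, whose type over `M` does not fork over some base of
size below `δ`. There are at most `Λ` such bases.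

The heart is `mk_le_of_inconsistent`: below a fixed node, at most `κ` immediate successors lie on
branches with a given base. Otherwise one finds a chain of `δ` models of size below `κ` and a
parameter set `A x` that depends on each model of the chain's successor over that model, against
local character. Each link of the chain comes from `exists_dependent`: if no model worked, there
would be a long independent sequence of parameter sets. Counting Galois types yields infinitely many
terms whose realizations have the same type over the base, and type-amalgamation then realizes `k`
of the inconsistent types at once.

A diagonal argument finishes. Split the bases into pieces `P β`, `β < μ`, each of size below `Λ`. At
level `β`, fewer than `Λ` successors are met by branches with a base in `P β`, so one can leave the
node by another successor. The branch built in this way can have no base at all. -/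

namespace AEC

/-! ### Strong embeddings and Löwenheim–Skolem submodels. -/

section Basic

open FirstOrder.Language

variable {L : FirstOrder.Language.{w, w}} (K : AEC L)

theorem isLSBound_LS : IsLSBound K.Mem K.Strong K.LS :=
  csInf_mem (s := {lam | IsLSBound K.Mem K.Strong lam}) K.exists_isLSBound

theorem aleph0_le_LS : ℵ₀ ≤ K.LS := K.isLSBound_LS.1

variable {K}

theorem isKEmb_subtype {N : Type w} [L.Structure N] {S : L.Substructure N} (h : K.Strong N S) :
    K.IsKEmb S.subtype := by
  unfold IsKEmb
  rwa [Substructure.range_subtype]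

theorem strong_map {M N : Type w} [L.Structure M] [L.Structure N] {g : M ↪[L] N}
    (hg : K.IsKEmb g) {S : L.Substructure M} (hS : K.Strong M S) :
    K.Strong N (S.map g.toHom) := by
  have h1 := K.strong_of_equiv g.equivRange hS
  refine K.strong_trans (T := g.toHom.range) ?_ ?_ hg
  · rintro _ ⟨x, -, rfl⟩
    exact ⟨x, rfl⟩
  · convert h1 using 1
    ext y
    constructor
    · rintro ⟨x, hx, hxy⟩
      exact ⟨x, hx, Subtype.ext hxy⟩
    · rintro ⟨x, hx, rfl⟩
      exact ⟨x, hx, rfl⟩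

theorem IsKEmb.comp {M N P : Type w} [L.Structure M] [L.Structure N] [L.Structure P]
    {g : N ↪[L] P} {f : M ↪[L] N} (hg : K.IsKEmb g) (hf : K.IsKEmb f) : K.IsKEmb (g.comp f) := by
  have := strong_map hg hf
  unfold IsKEmb
  convert this using 1
  ext y
  simp [Substructure.mem_map]

theorem IsKEmb.codRestrict {M N : Type w} [L.Structure M] [L.Structure N] {f : M ↪[L] N}
    (hf : K.IsKEmb f) {S : L.Substructure N} (hS : K.Strong N S) (h : ∀ x, f x ∈ S) :
    K.IsKEmb (f.codRestrict S h) := by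
  have hle : f.toHom.range ≤ S := by
    rintro _ ⟨x, rfl⟩
    exact h x
  have := K.coherence hle hf hS
  unfold IsKEmb
  convert this using 1
  ext y
  constructor
  · rintro ⟨x, rfl⟩
    exact ⟨x, rfl⟩
  · rintro ⟨x, hxy⟩
    exact ⟨x, Subtype.ext hxy⟩

theorem exists_strong {N : Type w} [L.Structure N] (hN : K.Mem N) (A : Set N) :
    ∃ S : L.Substructure N, K.Strong N S ∧ A ⊆ (S : Set N) ∧ #S ≤ #A + K.LS :=
  K.isLSBound_LS.2.2 N hN A

theorem exists_strong_le {N : Type w} [L.Structure N] {M : L.Substructure N} (hM : K.Strong N M)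
    {A : Set N} (hA : A ⊆ M) :
    ∃ S : L.Substructure N, K.Strong N S ∧ S ≤ M ∧ A ⊆ (S : Set N) ∧ #S ≤ #A + K.LS := by
  obtain ⟨S, hS, hAS, hc⟩ := exists_strong (K.mem_of_strong hM).1 (Subtype.val ⁻¹' A : Set M)
  refine ⟨S.map M.subtype.toHom, strong_map (isKEmb_subtype hM) hS, ?_, ?_, ?_⟩
  · rintro _ ⟨x, -, rfl⟩
    exact x.2
  · intro a ha
    exact ⟨⟨a, hA ha⟩, hAS ha, rfl⟩
  · have h1 : #(S.map M.subtype.toHom) ≤ #S := mk_image_le (f := Subtype.val) (s := (S : Set M))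
    refine h1.trans (hc.trans ?_)
    gcongr
    exact mk_preimage_of_injective _ _ Subtype.val_injective

end Basic

/-- Transfinite construction of a sequence in which any two members are related. -/
theorem exists_chain {ι : Type*} [LinearOrder ι] [WellFoundedLT ι] {P : Type*} [Nonempty P]
    (R : P → P → Prop) (Q : ι → P → Prop)
    (H : ∀ (i : ι) (f : Set.Iio i → P), (∀ j k : Set.Iio i, j < k → R (f j) (f k)) →
      (∀ j : Set.Iio i, Q j (f j)) →
      ∃ q, (∀ j, R (f j) q) ∧ Q i q) :
    ∃ f : ι → P, (∀ j k, j < k → R (f j) (f k)) ∧ ∀ i, Q i (f i) := by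
  -- `epsilon` makes the recursion total; that its choices meet the requirements is proved
  -- afterwards by induction.
  classical
  let step : ∀ i : ι, (∀ j, j < i → P) → P := fun i f =>
    Classical.epsilon fun q => (∀ j (h : j < i), R (f j h) q) ∧ Q i q
  let F : ι → P := (wellFounded_lt (α := ι)).fix step
  have hF : ∀ i, F i = step i fun j _ => F j := fun i => WellFounded.fix_eq _ _ _
  have key : ∀ i, (∀ j, j < i → R (F j) (F i)) ∧ Q i (F i) := by
    intro i
    induction i using (wellFounded_lt (α := ι)).induction with
    | _ i ih =>
      obtain ⟨q, hq1, hq2⟩ := H i (fun j => F j) (fun j k hjk => (ih k k.2).1 j hjk)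
        (fun j => (ih j j.2).2)
      have := Classical.epsilon_spec (p := fun q => (∀ j (h : j < i), R (F j) q) ∧ Q i q)
        ⟨q, fun j h => hq1 ⟨j, h⟩, hq2⟩
      rw [hF i]
      exact this
  exact ⟨F, fun j k h => (key k).1 j h, fun i => (key i).2⟩

/-! ### Extending and gluing partial embeddings of the monster model. -/

section Extension

open FirstOrder.Language

variable {L : FirstOrder.Language.{w, w}} {K : AEC L} {C : Type w} [L.Structure C]

theorem IsMonster.exists_smallModel (hC : K.IsMonster C) {A : Set C} (hA : #A < #C) :
    ∃ M : L.Substructure C, K.SmallModel M ∧ A ⊆ M ∧ #M ≤ #A + K.LS := by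
  obtain ⟨S, h1, h2, h3⟩ := exists_strong hC.mem A
  exact ⟨S, ⟨h1, h3.trans_lt (add_lt_of_lt hC.inaccessible.isRegular.1 hA hC.LS_lt)⟩, h2, h3⟩

/-- `e` restricts to a `K`-embedding of `M` into `C`. -/
def IsKEmbOn (K : AEC L) (M : L.Substructure C) (e : C → C) : Prop :=
  ∃ g : M ↪[L] C, K.IsKEmb g ∧ ∀ x : M, g x = e x

theorem IsMonster.exists_extension (hC : K.IsMonster C) {M M' : L.Substructure C}
    (hM : K.SmallModel M) (hM' : K.SmallModel M') (hle : M ≤ M') {e : C → C}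
    (he : K.IsKEmbOn M e) : ∃ e', K.IsKEmbOn M' e' ∧ ∀ x ∈ M, e' x = e x := by
  classical
  obtain ⟨g, hg, h2⟩ := he
  have hi : K.IsKEmb (Substructure.inclusion hle) :=
    (isKEmb_subtype hM.1).codRestrict hM'.1 _
  obtain ⟨f, hf, hfx⟩ := hC.homogeneous M M' (Substructure.inclusion hle) g hM.2 hM'.2 hi hg
  refine ⟨fun x => if h : x ∈ M' then f ⟨x, h⟩ else x, ⟨f, hf, fun x => by simp⟩, fun x hx => ?_⟩
  have := hfx ⟨x, hx⟩
  rw [h2] at this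
  simp only [hle hx, dite_true]
  exact this

/-- Any finite tuple from the union lies in a single `M i`, so the glued map inherits injectivity,
functions and relations from the `e i`. Its range is the union of the chain of ranges, hence strong
by `union_strong`. -/
theorem exists_union {ι : Type w} [LinearOrder ι] [WellFoundedLT ι] [Nonempty ι]
    {M : ι → L.Substructure C} {e : ι → C → C} (hM : ∀ i, K.Strong C (M i))
    (he : ∀ i, K.IsKEmbOn (M i) (e i))
    (hle : ∀ i j, i < j → M i ≤ M j ∧ ∀ x ∈ M i, e j x = e i x) :
    ∃ e', K.Strong C (⨆ i, M i) ∧ (((⨆ i, M i : L.Substructure C)) : Set C) = ⋃ i, (M i : Set C) ∧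
      K.IsKEmbOn (⨆ i, M i) e' ∧ ∀ i, ∀ x ∈ M i, e' x = e i x := by
  classical
  have hmono : Monotone M := fun i j hij => by
    rcases hij.eq_or_lt with rfl | h
    · exact le_rfl
    · exact (hle i j h).1
  have hmem : ∀ x, x ∈ (⨆ i, M i) ↔ ∃ i, x ∈ M i := fun x =>
    Substructure.mem_iSup_of_directed hmono.directed_le
  have hset : (((⨆ i, M i : L.Substructure C)) : Set C) = ⋃ i, (M i : Set C) := by
    ext x
    simp [hmem]
  have hagree : ∀ i j x, x ∈ M i → x ∈ M j → e i x = e j x := by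
    intro i j x hi hj
    rcases lt_trichotomy i j with h | rfl | h
    · exact ((hle i j h).2 x hi).symm
    · rfl
    · exact (hle j i h).2 x hj
  let e' : C → C := fun x => if h : ∃ i, x ∈ M i then e h.choose x else x
  have he' : ∀ i, ∀ x ∈ M i, e' x = e i x := by
    intro i x hx
    have h : ∃ i, x ∈ M i := ⟨i, hx⟩
    simp only [e', h, dite_true]
    exact hagree _ _ _ h.choose_spec hx
  choose g hg hge using he
  have hfin : ∀ {n : ℕ} (x : Fin n → (⨆ i, M i : L.Substructure C)), ∃ i, ∀ k, (x k : C) ∈ M i := by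
    intro n x
    choose s hs using fun k => (hmem (x k)).1 (x k).2
    obtain ⟨i, hi⟩ := Finite.exists_le s
    exact ⟨i, fun k => hmono (hi k) (hs k)⟩
  let G : (⨆ i, M i : L.Substructure C) ↪[L] C :=
    { toFun := fun x => e' x
      inj' := by
        intro x y hxy
        obtain ⟨i, hi⟩ := hfin ![x, y]
        have hx : (x : C) ∈ M i := hi 0
        have hy : (y : C) ∈ M i := hi 1
        simp only [he' i _ hx, he' i _ hy] at hxy
        rw [← hge i ⟨x, hx⟩, ← hge i ⟨y, hy⟩] at hxy
        have := (g i).injective hxy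
        exact Subtype.ext (by simpa using this)
      map_fun' := by
        intro n f x
        obtain ⟨i, hi⟩ := hfin x
        have h1 := (g i).map_fun f fun k => ⟨x k, hi k⟩
        have h2 : ((FirstOrder.Language.Structure.funMap f x : (⨆ i, M i : L.Substructure C)) : C) =
          (FirstOrder.Language.Structure.funMap f (fun k => (⟨x k, hi k⟩ : M i)) : M i) := rfl
        rw [h2, he' i _ (Subtype.property _), ← hge, h1]
        congr 1
        ext k
        simp only [Function.comp, hge]
        exact (he' i _ (hi k)).symm
      map_rel' := by
        intro n r x
        obtain ⟨i, hi⟩ := hfin x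
        have h1 := (g i).map_rel r fun k => ⟨x k, hi k⟩
        have h2 : (FirstOrder.Language.Structure.RelMap r x) ↔
          (FirstOrder.Language.Structure.RelMap r (fun k => (⟨x k, hi k⟩ : M i))) := Iff.rfl
        rw [h2, ← h1]
        have : ((fun x : (⨆ i, M i : L.Substructure C) => e' x) ∘ x) =
            (g i) ∘ fun k => ⟨x k, hi k⟩ := by
          ext k
          simp only [Function.comp, hge]
          exact he' i _ (hi k)
        rw [this] }
  refine ⟨e', K.union_strong M hmono hM _ hset, hset, ⟨G, ?_, fun _ => rfl⟩, he'⟩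
  refine K.union_strong (fun i => (g i).toHom.range) ?_ hg _ ?_
  · rintro i j hij _ ⟨x, rfl⟩
    refine ⟨⟨x, hmono hij x.2⟩, ?_⟩
    change g j _ = g i _
    rw [hge, hge]
    exact hagree _ _ _ (hmono hij x.2) x.2
  · ext y
    simp only [Set.mem_iUnion, SetLike.mem_coe]
    constructor
    · rintro ⟨x, rfl⟩
      obtain ⟨i, hi⟩ := (hmem x).1 x.2
      refine ⟨i, ⟨x, hi⟩, ?_⟩
      change g i _ = e' x
      rw [hge, he' i _ hi]
    · rintro ⟨i, x, rfl⟩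
      refine ⟨⟨x, (hmem x).2 ⟨i, x.2⟩⟩, ?_⟩
      change e' x = g i _
      rw [hge, he' i _ x.2]

end Extension

theorem mk_Iio_toType_lt {c : Cardinal.{w}} (i : c.ord.ToType) : #(Set.Iio i) < c := by
  simpa using mk_Iio_lt i (by simp)

/-! ### Galois types through self-embeddings of the monster model, and their number. -/

section TpEq

open FirstOrder.Language

variable {L : FirstOrder.Language.{w, w}} {K : AEC L} {C : Type w} [L.Structure C]

theorem isKEmb_refl {N : Type w} [L.Structure N] (hN : K.Mem N) :
    K.IsKEmb (Embedding.refl L N) := by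
  unfold IsKEmb
  convert K.strong_refl hN
  ext x
  simp

/-- Enumerate `C` in order type `‖C‖` and absorb one element at each stage, gluing what has been
built so far. Regularity of `‖C‖` keeps the domains small before the last union. -/
theorem IsMonster.exists_extension_all (hC : K.IsMonster C) {M : L.Substructure C}
    (hM : K.SmallModel M) {e : C → C} (he : K.IsKEmbOn M e) :
    ∃ f : C ↪[L] C, K.IsKEmb f ∧ ∀ x ∈ M, f x = e x := by
  have hreg := hC.inaccessible.isRegular
  have hcard : #(#C).ord.ToType = #C := by simp
  obtain ⟨c⟩ := Cardinal.eq.1 hcard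
  have : Nonempty (L.Substructure C × (C → C)) := ⟨(M, e)⟩
  obtain ⟨F, hF1, hF2⟩ := exists_chain (ι := (#C).ord.ToType) (P := L.Substructure C × (C → C))
    (fun p q => p.1 ≤ q.1 ∧ ∀ x ∈ p.1, q.2 x = p.2 x)
    (fun i p => K.SmallModel p.1 ∧ K.IsKEmbOn p.1 p.2 ∧ (M ≤ p.1 ∧ ∀ x ∈ M, p.2 x = e x) ∧
      c i ∈ p.1) (by
    intro i f hf1 hf2
    -- This handles zero, successor and limit stages together: with no predecessors start from `(M,
    -- e)`, otherwise take the union.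
    have base : ∃ p : L.Substructure C × (C → C), K.SmallModel p.1 ∧ K.IsKEmbOn p.1 p.2 ∧
        (M ≤ p.1 ∧ ∀ x ∈ M, p.2 x = e x) ∧
        ∀ j, (f j).1 ≤ p.1 ∧ ∀ x ∈ (f j).1, p.2 x = (f j).2 x := by
      rcases isEmpty_or_nonempty (Set.Iio i) with hemp | hne
      · exact ⟨(M, e), hM, he, ⟨le_rfl, fun _ _ => rfl⟩, fun j => (hemp.false j).elim⟩
      · obtain ⟨e', h1, h2, h3, h4⟩ := exists_union (K := K) (M := fun j => (f j).1)
          (e := fun j => (f j).2) (fun j => (hf2 j).1.1) (fun j => (hf2 j).2.1) hf1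
        have j₀ := hne.some
        refine ⟨(⨆ j, (f j).1, e'), ⟨h1, ?_⟩, h3, ⟨?_, ?_⟩, fun j => ⟨?_, h4 j⟩⟩
        · change #(((⨆ j, (f j).1 : L.Substructure C)) : Set C) < #C
          rw [h2, card_iUnion_lt_iff_forall_of_isRegular hreg]
          · exact fun j => (hf2 j).1.2
          · exact mk_Iio_toType_lt i
        · exact (hf2 j₀).2.2.1.1.trans (le_iSup (fun j => (f j).1) j₀)
        · intro x hx
          exact (h4 j₀ x ((hf2 j₀).2.2.1.1 hx)).trans ((hf2 j₀).2.2.1.2 x hx)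
        · exact le_iSup (fun j => (f j).1) j
    obtain ⟨⟨U, eU⟩, hU, heU, ⟨hMU, hMe⟩, hR⟩ := base
    have hsm : #((U : Set C) ∪ {c i} : Set C) < #C :=
      (mk_union_le _ _).trans_lt (add_lt_of_lt hreg.1 hU.2
        (by simpa using one_lt_aleph0.trans_le hreg.1))
    obtain ⟨M', hM', hsub, -⟩ := hC.exists_smallModel hsm
    have hle : U ≤ M' := fun x hx => hsub (Or.inl hx)
    obtain ⟨e', he', hee⟩ := hC.exists_extension hU hM' hle heU
    refine ⟨(M', e'), fun j => ⟨(hR j).1.trans hle, fun x hx => ?_⟩, hM', he',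
      ⟨hMU.trans hle, fun x hx => ?_⟩, hsub (Or.inr rfl)⟩
    · exact (hee x ((hR j).1 hx)).trans ((hR j).2 x hx)
    · exact (hee x (hMU hx)).trans (hMe x hx))
  have : Nonempty (#C).ord.ToType := by
    rw [← mk_ne_zero_iff, hcard]
    exact hC.inaccessible.ne_zero
  obtain ⟨e', h1, h2, ⟨g, hg, hge⟩, h4⟩ := exists_union (K := K) (M := fun j => (F j).1)
    (e := fun j => (F j).2) (fun j => (hF2 j).1.1) (fun j => (hF2 j).2.1) hF1
  have htop : ∀ x, x ∈ (⨆ j, (F j).1) := by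
    intro x
    have := (hF2 (c.symm x)).2.2.2
    rw [Equiv.apply_symm_apply] at this
    exact le_iSup (fun j => (F j).1) _ this
  let t : C ↪[L] (⨆ j, (F j).1 : L.Substructure C) :=
    (Embedding.refl L C).codRestrict _ htop
  refine ⟨g.comp t, hg.comp ((isKEmb_refl hC.mem).codRestrict h1 _), fun x hx => ?_⟩
  have i₀ := Classical.arbitrary (#C).ord.ToType
  have h5 : g (t x) = e' x := hge _
  rw [Embedding.comp_apply, h5, h4 i₀ x ((hF2 i₀).2.2.1.1 hx), (hF2 i₀).2.2.1.2 x hx]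

/-- A self-embedding, not necessarily onto, is enough for equality of types, so extending in the
forth direction suffices and no back-and-forth is required. -/
theorem IsMonster.tpEq_iff (hC : K.IsMonster C) {I : Type w} {A : Set C} {b₁ b₂ : I → C}
    (hA : #A < #C) (hI : #I < #C) :
    K.TpEq A b₁ b₂ ↔ ∃ f : C ↪[L] C, K.IsKEmb f ∧ (∀ a ∈ A, f a = a) ∧ ∀ i, f (b₂ i) = b₁ i := by
  constructor
  · rintro ⟨N, hN, f₁, f₂, hf₁, hf₂, hA', hb⟩
    have small : ∀ b : I → C, #(A ∪ Set.range b : Set C) < #C := fun b =>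
      (mk_union_le _ _).trans_lt (add_lt_of_lt hC.inaccessible.isRegular.1 hA
        (mk_range_le.trans_lt hI))
    obtain ⟨M₁, hM₁, hs₁, -⟩ := hC.exists_smallModel (small b₁)
    obtain ⟨M₂, hM₂, hs₂, -⟩ := hC.exists_smallModel (small b₂)
    obtain ⟨S, hS, hsub, hcard⟩ := exists_strong (K := K) (K.mem_of_strong hf₁).2
      (f₁ '' M₁ ∪ f₂ '' M₂)
    have hSlt : #S < #C := by
      refine hcard.trans_lt (add_lt_of_lt hC.inaccessible.isRegular.1
        ((mk_union_le _ _).trans_lt (add_lt_of_lt hC.inaccessible.isRegular.1 ?_ ?_)) hC.LS_lt)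
      · exact mk_image_le.trans_lt hM₁.2
      · exact mk_image_le.trans_lt hM₂.2
    have hk₁ := (hf₁.comp (isKEmb_subtype hM₁.1)).codRestrict hS
      fun x => hsub (Or.inl ⟨x, x.2, rfl⟩)
    have hk₂ := (hf₂.comp (isKEmb_subtype hM₂.1)).codRestrict hS
      fun x => hsub (Or.inr ⟨x, x.2, rfl⟩)
    -- Embed the small amalgam `S` into `C` over `M₁`; after `f₂` this is an embedding of `M₂` that
    -- fixes `A` and sends `b₂` to `b₁`.
    obtain ⟨g, hg, hgi⟩ := hC.homogeneous M₁ S _ M₁.subtype hM₁.2 hSlt hk₁ (isKEmb_subtype hM₁.1)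
    classical
    obtain ⟨f, hf, hfe⟩ := hC.exists_extension_all hM₂
      (e := fun x => if h : x ∈ M₂ then
        (g.comp ((f₂.comp M₂.subtype).codRestrict S fun x => hsub (Or.inr ⟨x, x.2, rfl⟩))) ⟨x, h⟩
        else x) ⟨_, hg.comp hk₂, fun x => by simp⟩
    have key : ∀ x y, x ∈ M₁ → y ∈ M₂ → f₁ x = f₂ y → f y = x := by
      intro x y hx hy hxy
      rw [hfe y hy, dif_pos hy, Embedding.comp_apply]
      refine Eq.trans ?_ (hgi ⟨x, hx⟩)
      congr 1
      exact Subtype.ext hxy.symm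
    exact ⟨f, hf, fun a ha => key a a (hs₁ (Or.inl ha)) (hs₂ (Or.inl ha)) (hA' a ha),
      fun i => key _ _ (hs₁ (Or.inr ⟨i, rfl⟩)) (hs₂ (Or.inr ⟨i, rfl⟩)) (hb i)⟩
  · rintro ⟨f, hf, hfA, hfb⟩
    refine ⟨C, inferInstance, Embedding.refl L C, f, isKEmb_refl hC.mem, hf,
      fun a ha => (hfA a ha).symm, fun i => (hfb i).symm⟩

theorem IsMonster.tpEq_trans (hC : K.IsMonster C) {I : Type w} {A : Set C} {b₁ b₂ b₃ : I → C}
    (hA : #A < #C) (hI : #I < #C) (h : K.TpEq A b₁ b₂) (h' : K.TpEq A b₂ b₃) :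
    K.TpEq A b₁ b₃ := by
  rw [hC.tpEq_iff hA hI] at *
  obtain ⟨f, hf, hfA, hfb⟩ := h
  obtain ⟨g, hg, hgA, hgb⟩ := h'
  exact ⟨f.comp g, hf.comp hg, fun a ha => by simp [hgA a ha, hfA a ha],
    fun i => by simp [hgb, hfb]⟩

theorem TpEq.mono {I : Type w} {A A' : Set C} {b₁ b₂ : I → C} (h : K.TpEq A b₁ b₂)
    (hA : A' ⊆ A) : K.TpEq A' b₁ b₂ := by
  obtain ⟨N, hN, f₁, f₂, h1, h2, h3, h4⟩ := h
  exact ⟨N, hN, f₁, f₂, h1, h2, fun a ha => h3 a (hA ha), h4⟩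

/-- The number of Galois types of elements over a small set `A` is at most `2 ^ (#A + LS(K))`. -/
theorem IsMonster.exists_code (hC : K.IsMonster C) {A : Set C} (hA : #A < #C) :
    ∃ (E : Type w) (code : C → E), #E ≤ 2 ^ (#A + K.LS) ∧
      ∀ c c', code c = code c' → K.Realizes c c' A := by
  classical
  have hsm : ∀ c, #(A ∪ {c} : Set C) ≤ #A + 1 := fun c => (mk_union_le _ _).trans (by simp)
  have hA1 : #A + 1 < #C := add_lt_of_lt hC.inaccessible.isRegular.1 hA
    (one_lt_aleph0.trans_le hC.inaccessible.isRegular.1)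
  choose M hM hsub hcard using fun c => hC.exists_smallModel ((hsm c).trans_lt hA1)
  let T : Type w := (#A + K.LS).out
  have hLS : ℵ₀ ≤ #A + K.LS := K.aleph0_le_LS.trans (self_le_add_left _ _)
  have hT : ∀ c, #(M c) ≤ #T := by
    intro c
    rw [mk_out]
    refine (hcard c).trans ?_
    calc #(A ∪ {c} : Set C) + K.LS ≤ (#A + 1) + K.LS := by gcongr; exact hsm c
      _ = #A + (1 + K.LS) := add_assoc _ _ _
      _ = #A + K.LS := by rw [add_eq_right K.aleph0_le_LS (one_le_aleph0.trans K.aleph0_le_LS)]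
  have hne : ∀ c, Nonempty (M c) := fun c => ⟨⟨c, hsub c (Or.inr rfl)⟩⟩
  have hs : ∀ c, ∃ s : T → M c, Function.Surjective s := by
    intro c
    obtain ⟨j⟩ := Cardinal.le_def _ _ |>.1 (hT c)
    exact ⟨Function.invFun j, Function.invFun_surjective j.injective⟩
  choose s hs using hs
  -- The code of `c` is the set of formulas true of an enumeration of `M c` by `T`, with extra names
  -- for `A` and for `c`. Equal codes give an isomorphism of `M c'` onto `M c` that respects these
  -- names.
  let V : Type w := Option (A ⊕ T)
  let v : C → V → C := fun c x => x.elim c (Sum.elim Subtype.val fun t => (s c t : C))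
  have hv : ∀ c x, v c x ∈ M c := by
    rintro c (_ | a | t)
    · exact hsub c (Or.inr rfl)
    · exact hsub c (Or.inl a.2)
    · exact (s c t).2
  refine ⟨Set (L.Formula V), fun c => {φ | φ.Realize (v c)}, ?_, ?_⟩
  · rw [mk_set]
    refine power_le_power_left two_ne_zero ?_
    have h1 : #(L.Formula V) ≤ #(Σ n, L.BoundedFormula V n) :=
      mk_le_of_injective (f := fun φ => ⟨0, φ⟩) fun φ ψ h => by simpa using h
    refine h1.trans (BoundedFormula.card_le.trans ?_)
    simp only [lift_id]
    refine max_le hLS (add_le_of_le hLS ?_ (K.isLSBound_LS.2.1.trans (self_le_add_left _ _)))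
    simp only [V, mk_option, mk_sum, lift_id, T, mk_out]
    exact add_le_of_le hLS (add_le_of_le hLS (self_le_add_right _ _) le_rfl) (one_le_aleph0.trans hLS)
  · intro c c' h
    have h' : ∀ φ : L.Formula V, φ.Realize (v c) ↔ φ.Realize (v c') := fun φ =>
      Set.ext_iff.1 h φ
    have hsurj : ∀ x : M c', ∃ y : V, v c' y = x := by
      intro x
      obtain ⟨t, ht⟩ := hs c' x
      exact ⟨some (Sum.inr t), by simp [v, ht]⟩
    choose p hp using hsurj
    have heq : ∀ x y, v c' x = v c' y ↔ v c x = v c y := by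
      intro x y
      have := h' (Term.equal (FirstOrder.Language.var x) (FirstOrder.Language.var y))
      simpa using this.symm
    let g : M c' ↪[L] C :=
      { toFun := fun x => v c (p x)
        inj' := by
          intro x y hxy
          have := (heq _ _).2 hxy
          rw [hp, hp] at this
          exact Subtype.ext this
        map_fun' := by
          intro n f x
          have := h' (Term.equal (FirstOrder.Language.var (p (Structure.funMap f x)))
            (Term.func f fun k => FirstOrder.Language.var (p (x k))))
          simp only [Formula.realize_equal, Term.realize_var, Term.realize_func, hp] at this
          exact this.2 rfl
        map_rel' := by
          intro n r x
          have := h' (Relations.formula r fun k => FirstOrder.Language.var (p (x k)))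
          simp only [Formula.realize_rel, Term.realize_var, hp] at this
          exact this }
    have hpv : ∀ (y : V) (h : v c' y ∈ M c'), v c (p ⟨v c' y, h⟩) = v c y := fun y h =>
      (heq _ _).1 (hp ⟨v c' y, h⟩)
    have hg : K.IsKEmb g := by
      unfold IsKEmb
      convert (hM c).1
      ext x
      constructor
      · rintro ⟨y, rfl⟩
        exact hv c _
      · intro hx
        obtain ⟨t, ht⟩ := hs c ⟨x, hx⟩
        refine ⟨⟨v c' (some (Sum.inr t)), hv c' _⟩, (hpv _ _).trans ?_⟩
        simp [v, ht]
    obtain ⟨f, hf, hfg⟩ := hC.exists_extension_all (hM c')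
      (e := fun x => if h : x ∈ M c' then g ⟨x, h⟩ else x) ⟨g, hg, fun x => by simp⟩
    have hfv : ∀ y : V, f (v c' y) = v c y := fun y => by
      rw [hfg _ (hv c' y), dif_pos (hv c' y)]
      exact hpv y _
    refine (hC.tpEq_iff hA ?_).2 ⟨f, hf, fun a ha => hfv (some (Sum.inl ⟨a, ha⟩)),
      fun _ => hfv none⟩
    simpa using one_lt_aleph0.trans_le hC.inaccessible.isRegular.1

end TpEq

/-- A family of fewer than `δ` elements of the well-order `δ` is bounded, for regular `δ`. -/
theorem exists_forall_lt_of_isRegular {δ : Cardinal.{w}} (hδ : δ.IsRegular) {J : Type w}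
    (hJ : #J < δ) (t : J → δ.ord.ToType) : ∃ i, ∀ j, t j < i := by
  by_contra! h
  have hcof : IsCofinal (Set.range t) := fun i => by
    obtain ⟨j, hj⟩ := h i
    exact ⟨t j, ⟨j, rfl⟩, hj⟩
  have := Order.cof_le hcof
  rw [Ordinal.cof_toType, hδ.cof_ord] at this
  exact (this.trans mk_range_le).not_gt hJ

theorem mk_iUnion_lt_of_lt_cof {α ι : Type w} {κ : Cardinal.{w}} (hκ : ℵ₀ ≤ κ) {f : ι → Set α}
    (hι : #ι < κ.ord.cof) (hf : ∀ i, #(f i) < κ) : #(⋃ i, f i) < κ :=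
  (mk_iUnion_le f).trans_lt (mul_lt_of_lt hκ (hι.trans_le (Ordinal.cof_ord_le κ))
    (iSup_lt_of_lt_cof_ord hι hf))

/-! ### Type-amalgamation along independent sequences, and the bound on inconsistent families. -/

section Amalgamation

variable {L : FirstOrder.Language.{w, w}} {K : AEC L} {C : Type w} [L.Structure C]
  {D : L.Substructure C → Set C → Set C → Prop}

theorem IsMonster.realizes_trans (hC : K.IsMonster C) {A : Set C} (hA : #A < #C) {a b c : C}
    (h : K.Realizes a b A) (h' : K.Realizes b c A) : K.Realizes a c A :=
  hC.tpEq_trans hA (by simpa using one_lt_aleph0.trans_le hC.inaccessible.isRegular.1) h h'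

theorem Realizes.mono {a b : C} {A A' : Set C} (h : K.Realizes a b A) (hA : A' ⊆ A) :
    K.Realizes a b A' :=
  TpEq.mono h hA

/-- The amalgam is again independent from the whole of `M` over `N`, so the lemma can be iterated.
-/
theorem IsSimpleIndependence.exists_amalgam (hD : K.IsSimpleIndependence D)
    (hC : K.IsMonster C) {N M : L.Substructure C} (hN : K.SmallModel N) (hM : K.SmallModel M)
    (hNM : N ≤ M) {A B : Set C} (hA : A ⊆ M) (hB : B ⊆ M) (hAB : D N A B) {c₁ c₂ : C}
    (h₁₂ : K.Realizes c₁ c₂ N) (h₁ : D N {c₁} M) (h₂ : D N {c₂} M) :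
    ∃ c, K.Realizes c c₁ (A ∪ N) ∧ K.Realizes c c₂ (B ∪ N) ∧ D N {c} M := by
  have small : ∀ {Z : Set C}, Z ⊆ M → #Z < #C := fun h => (mk_le_mk_of_subset h).trans_lt hM.2
  have h1 : (1 : Cardinal) < #C := one_lt_aleph0.trans_le hC.inaccessible.isRegular.1
  have hAN : A ∪ N ⊆ M := Set.union_subset hA hNM
  have hBN : B ∪ N ⊆ M := Set.union_subset hB hNM
  have hsing : ∀ c : C, #({c} : Set C) < #C := fun c => by simpa using h1
  obtain ⟨c, hc1, hc2, hc3⟩ := hD.typeAmalgamation N M (A ∪ N) (B ∪ N) hN hM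
    Set.subset_union_right Set.subset_union_right hAN hBN
    ((hD.normality N A B hN (small hA) (small hB)).1 hAB) PUnit (fun _ => c₁) (fun _ => c₂)
    (by simpa using h1) h₁₂
    (by
      rw [Set.range_const]
      exact hD.monotonicity N _ _ _ _ hN (hsing _) hM.2 subset_rfl hAN h₁)
    (by
      rw [Set.range_const]
      exact hD.monotonicity N _ _ _ _ hN (hsing _) hM.2 subset_rfl hBN h₂)
  have hcc : c = fun _ => c PUnit.unit := rfl
  rw [hcc] at hc1 hc2 hc3
  rw [Set.range_const] at hc3
  exact ⟨c PUnit.unit, hc1, hc2, hc3⟩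

/-- Realizations of one type over `N` can be amalgamated over finitely many members of an
independent sequence of sets. -/
theorem IsSimpleIndependence.exists_amalgam_finset (hD : K.IsSimpleIndependence D)
    (hC : K.IsMonster C) {N M : L.Substructure C} (hN : K.SmallModel N) (hM : K.SmallModel M)
    (hNM : N ≤ M) {ι : Type w} [LinearOrder ι] [Nonempty ι] {A : ι → Set C} {c : ι → C}
    (hA : ∀ i, A i ⊆ M) (hAind : ∀ i, D N (A i) (⋃ j : Set.Iio i, A j))
    (htp : ∀ i j, K.Realizes (c i) (c j) N) (hc : ∀ i, D N {c i} M) (s : Finset ι) :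
    ∃ d, (∀ i, K.Realizes d (c i) N) ∧ (∀ i ∈ s, K.Realizes d (c i) (A i)) ∧ D N {d} M := by
  classical
  have small : ∀ {Z : Set C}, Z ⊆ M → #Z < #C := fun h => (mk_le_mk_of_subset h).trans_lt hM.2
  induction s using Finset.induction_on_max with
  | empty =>
    have i₀ := Classical.arbitrary ι
    exact ⟨c i₀, fun i => htp i₀ i, by simp, hc i₀⟩
  | insert m s hlt ih =>
    obtain ⟨d, hd1, hd2, hd3⟩ := ih
    have hsub : (⋃ j ∈ s, A j) ⊆ ⋃ j : Set.Iio m, A j := by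
      intro x hx
      simp only [Set.mem_iUnion] at hx ⊢
      obtain ⟨j, hj, hx⟩ := hx
      exact ⟨⟨j, hlt j hj⟩, hx⟩
    have hM1 : (⋃ j : Set.Iio m, A j) ⊆ M := Set.iUnion_subset fun j => hA j
    -- Independence of `A m` from the earlier sets, turned round by symmetry: the sets already
    -- treated form the left side of the next amalgamation.
    have hind : D N (⋃ j ∈ s, A j) (A m) :=
      (hD.symmetry N _ _ hN (small (hA m)) (small (hsub.trans hM1))).1
        (hD.monotonicity N _ _ _ _ hN (small (hA m)) (small hM1) subset_rfl hsub (hAind m))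
    obtain ⟨e, he1, he2, he3⟩ := hD.exists_amalgam hC hN hM hNM (hsub.trans hM1) (hA m) hind
      (hd1 m) hd3 (hc m)
    refine ⟨e, fun i => hC.realizes_trans hN.2 (he2.mono Set.subset_union_right) (htp m i),
      fun i hi => ?_, he3⟩
    rcases Finset.mem_insert.1 hi with rfl | hi
    · exact he2.mono Set.subset_union_left
    · refine hC.realizes_trans (small (hA i)) (he1.mono ?_) (hd2 i hi)
      exact (Set.subset_biUnion_of_mem (u := A) (show i ∈ (s : Set ι) from hi)).trans
        Set.subset_union_left

/-- If the types `tp(c x / A x)` are `k`-inconsistent, then `A x` depends on some fixed `N'` over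
`N`, for all but boundedly many `x`. -/
theorem IsSimpleIndependence.exists_dependent (hD : K.IsSimpleIndependence D)
    (hC : K.IsMonster C) {N M : L.Substructure C} (hN : K.SmallModel N) (hM : K.SmallModel M)
    (hNM : N ≤ M) {X : Type w} {A : X → Set C} {c : X → C} {k : ℕ}
    (hAM : ∀ x, A x ⊆ M) (hA : ∀ x, #(A x) ≤ K.LS) (hc : ∀ x, D N {c x} M)
    (hk : ∀ s : Finset X, s.card = k → ¬ ∃ d, ∀ x ∈ s, K.Realizes d (c x) (A x)) :
    ∃ (N' : L.Substructure C) (S : Set X), K.SmallModel N' ∧ N ≤ N' ∧ N' ≤ M ∧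
      #N' ≤ Order.succ (2 ^ (#N + K.LS)) ∧ #S ≤ Order.succ (2 ^ (#N + K.LS)) ∧
      ∀ x ∉ S, ¬ D N (A x) N' := by
  classical
  rcases isEmpty_or_nonempty X with hX | hX
  · refine ⟨N, ∅, hN, le_rfl, hNM, ?_, by simp, fun x => hX.elim x⟩
    exact (self_le_add_right _ _).trans ((cantor _).le.trans (Order.le_succ _))
  by_contra! hcon
  set τ : Cardinal.{w} := Order.succ (2 ^ (#N + K.LS)) with hτ
  have hle : #N + K.LS ≤ τ := (cantor _).le.trans (Order.le_succ _)
  have hNτ : #N ≤ τ := (self_le_add_right _ _).trans hle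
  have hLSτ : K.LS ≤ τ := (self_le_add_left _ _).trans hle
  have hωτ : ℵ₀ ≤ τ := K.aleph0_le_LS.trans hLSτ
  -- Stage `i` picks a model containing `N` and all earlier parameter sets, and a new `x` with `A x`
  -- independent from that model over `N`.
  obtain ⟨F, hF1, hF2⟩ := exists_chain (ι := τ.ord.ToType) (P := L.Substructure C × X)
    (fun p q => A p.2 ⊆ q.1 ∧ p.2 ≠ q.2) (fun _ p => p.1 ≤ M ∧ D N (A p.2) p.1) (by
    intro i f _ _
    have hi : #(Set.Iio i) ≤ τ := (mk_Iio_toType_lt i).le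
    have hZM : ((N : Set C) ∪ ⋃ j, A (f j).2) ⊆ M :=
      Set.union_subset hNM (Set.iUnion_subset fun j => hAM _)
    obtain ⟨N', hN', hN'M, hsub, hcard⟩ := exists_strong_le hM.1 hZM
    have hZ : #((N : Set C) ∪ ⋃ j, A (f j).2 : Set C) ≤ τ := by
      refine (mk_union_le _ _).trans (add_le_of_le hωτ hNτ ((mk_iUnion_le _).trans ?_))
      exact mul_le_of_le hωτ hi (ciSup_le' fun j => (hA _).trans hLSτ)
    obtain ⟨x, hx1, hx2⟩ := hcon N' (Set.range fun j => (f j).2)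
      ⟨hN', (mk_le_mk_of_subset hN'M).trans_lt hM.2⟩ (Set.subset_union_left.trans hsub) hN'M
      (hcard.trans (add_le_of_le hωτ hZ hLSτ)) (mk_range_le.trans hi)
    exact ⟨(N', x), fun j => ⟨(Set.subset_iUnion (fun j => A (f j).2) j).trans
      (Set.subset_union_right.trans hsub), fun h => hx1 ⟨j, h⟩⟩, hN'M, hx2⟩)
  have hinj : Function.Injective fun i => (F i).2 := by
    intro i j hij
    by_contra hne
    rcases lt_or_gt_of_ne hne with h | h
    · exact (hF1 i j h).2 hij
    · exact (hF1 j i h).2 hij.symm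
  obtain ⟨E, code, hE, hcode⟩ := hC.exists_code hN.2
  have hinf : Infinite τ.ord.ToType := by
    rw [infinite_iff]
    simpa using hωτ
  -- There are more than `2 ^ (#N + LS(K))` indices, hence infinitely many with the same type over
  -- `N`.
  obtain ⟨e, he⟩ := exists_infinite_fiber (fun i => code (c (F i).2)) (by
    rw [mk_toType, card_ord]
    exact hE.trans_lt (Order.lt_succ _))
  let J := ((fun i => code (c (F i).2)) ⁻¹' {e} : Set τ.ord.ToType)
  have hJ : Infinite J := he
  obtain ⟨s, hs⟩ := Infinite.exists_subset_card_eq J k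
  have small : ∀ {Z : Set C}, Z ⊆ M → #Z < #C := fun h => (mk_le_mk_of_subset h).trans_lt hM.2
  obtain ⟨d, -, hd, -⟩ := hD.exists_amalgam_finset hC hN hM hNM (ι := J)
    (A := fun i => A (F i).2) (c := fun i => c (F i).2) (fun i => hAM _)
    (fun i => hD.monotonicity N _ _ _ _ hN (small (hAM _)) (small (hF2 i).1) subset_rfl
      (Set.iUnion_subset fun j => (hF1 _ _ j.2).1) (hF2 i).2)
    (fun i j => hcode _ _ (Eq.trans i.2 (Eq.symm j.2))) (fun i => hc _) s
  refine hk (s.image fun i : J => (F i).2) ?_ ⟨d, ?_⟩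
  · exact (Finset.card_image_of_injective s (hinj.comp Subtype.val_injective)).trans hs
  · intro x hx
    obtain ⟨i, hi, rfl⟩ := Finset.mem_image.1 hx
    exact hd i hi

/-- Iterating `exists_dependent` `δ` times stays below `κ`, because `κ` is a strong limit of
cofinality at least `δ`. At most `κ` indices are exceptional at some stage; any other `x` makes `A
x` fork at every step, contradicting local character over the union. -/
theorem IsSimpleIndependence.mk_le_of_inconsistent (hD : K.IsSimpleIndependence D)
    (hC : K.IsMonster C) {δ κ : Cardinal.{w}} (hδ : δ.IsRegular) (hκ : κ.IsStrongLimit)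
    (hcof : δ ≤ κ.ord.cof) (hLS : K.LS < κ)
    (hloc : ∀ N : L.Substructure C, K.SmallModel N → ∀ (I : Type w) [Nonempty I] (b : I → C),
      #I ≤ K.LS → ∃ N₀ : L.Substructure C, K.SmallModel N₀ ∧ N₀ ≤ N ∧ #N₀ < δ ∧
        D N₀ (Set.range b) N)
    {M₀ M : L.Substructure C} (hM₀ : K.SmallModel M₀) (hM : K.SmallModel M)
    (hle : M₀ ≤ M) (hM₀κ : #M₀ < κ) {X : Type w} {A : X → Set C} {c : X → C} {k : ℕ}
    (hAM : ∀ x, A x ⊆ M) (hA : ∀ x, #(A x) < K.LS) (hc : ∀ x, D M₀ {c x} M)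
    (hk : ∀ s : Finset X, s.card = k → ¬ ∃ d, ∀ x ∈ s, K.Realizes d (c x) (A x)) :
    #X ≤ κ := by
  classical
  by_contra! hX
  have hωκ : ℵ₀ ≤ κ := hκ.aleph0_le
  have hδκ : δ ≤ κ := hcof.trans (Ordinal.cof_ord_le κ)
  have small : ∀ {Z : Set C}, Z ⊆ M → #Z < #C := fun h => (mk_le_mk_of_subset h).trans_lt hM.2
  have hsing : ∀ c : C, #({c} : Set C) < #C := fun c => by
    simpa using one_lt_aleph0.trans_le hC.inaccessible.isRegular.1
  let P := {N : L.Substructure C // K.SmallModel N ∧ M₀ ≤ N ∧ N ≤ M ∧ #N < κ}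
  have hstep : ∀ N : P, ∃ (N' : P) (S : Set X), N.1 ≤ N'.1 ∧ #S < κ ∧
      ∀ x ∉ S, ¬ D N.1 (A x) N'.1 := by
    rintro ⟨N, hN, h1, h2, h3⟩
    have hlt : Order.succ (2 ^ (#N + K.LS)) < κ :=
      hκ.isSuccLimit.succ_lt (hκ.isStrongPrelimit (add_lt_of_lt hωκ h3 hLS))
    obtain ⟨N', S, hN', h4, h5, h6, h7, h8⟩ := hD.exists_dependent hC hN hM h2 hAM
      (fun x => (hA x).le)
      (fun x => hD.baseMonotonicity M₀ N _ _ hM₀ hN (hsing _) hM.2 h1 h2 (hc x)) hk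
    exact ⟨⟨N', hN', h1.trans h4, h5, h6.trans_lt hlt⟩, S, h4, h7.trans_lt hlt, h8⟩
  choose nx S hnx1 hS hnx2 using hstep
  have : Nonempty P := ⟨⟨M₀, hM₀, le_rfl, hle, hM₀κ⟩⟩
  obtain ⟨F, hF, -⟩ := exists_chain (ι := δ.ord.ToType) (P := P)
    (fun N N' => (nx N).1 ≤ N'.1) (fun _ _ => True) (by
    intro i f _ _
    have hZM : ((M₀ : Set C) ∪ ⋃ j, ((nx (f j)).1 : Set C)) ⊆ M :=
      Set.union_subset hle (Set.iUnion_subset fun j => (nx (f j)).2.2.2.1)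
    obtain ⟨N', hN', hN'M, hsub, hcard⟩ := exists_strong_le hM.1 hZM
    have hZ : #((M₀ : Set C) ∪ ⋃ j, ((nx (f j)).1 : Set C) : Set C) < κ :=
      (mk_union_le _ _).trans_lt (add_lt_of_lt hωκ hM₀κ
        (mk_iUnion_lt_of_lt_cof hωκ ((mk_Iio_toType_lt i).trans_le hcof)
          fun j => (nx (f j)).2.2.2.2))
    refine ⟨⟨N', ⟨hN', small hN'M⟩, Set.subset_union_left.trans hsub, hN'M,
      hcard.trans_lt (add_lt_of_lt hωκ hZ hLS)⟩, fun j => ?_, trivial⟩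
    exact (Set.subset_iUnion (fun j => ((nx (f j)).1 : Set C)) j).trans
      (Set.subset_union_right.trans hsub))
  have hcardδ : #δ.ord.ToType = δ := by simp
  have hne : Nonempty δ.ord.ToType := by
    rw [← mk_ne_zero_iff, hcardδ]
    exact hδ.ne_zero
  have hmono : Monotone fun i => (F i).1 := fun i j hij => by
    rcases hij.eq_or_lt with rfl | h
    · exact le_rfl
    · exact (hnx1 _).trans (hF i j h)
  have hmem : ∀ x, x ∈ (⨆ i, (F i).1) ↔ ∃ i, x ∈ (F i).1 := fun x =>
    FirstOrder.Language.Substructure.mem_iSup_of_directed hmono.directed_le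
  have hUM : (⨆ i, (F i).1) ≤ M := iSup_le fun i => (F i).2.2.2.1
  have hU : K.SmallModel (⨆ i, (F i).1) :=
    ⟨K.union_strong _ hmono (fun i => (F i).2.1.1) _ (by ext x; simp [hmem]), small hUM⟩
  obtain ⟨x, hx⟩ : ∃ x, x ∉ ⋃ i, S (F i) := by
    by_contra! h
    refine hX.not_ge ?_
    rw [← mk_univ, ← Set.eq_univ_of_forall h]
    refine (mk_iUnion_le _).trans (mul_le_of_le hωκ (hcardδ.trans_le hδκ)
      (ciSup_le' fun i => (hS _).le))
  rw [Set.mem_iUnion, not_exists] at hx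
  -- The entry `c x` only ensures that the sequence is nonempty, since `A x` may be empty.
  let b : Option (A x) → C := fun y => y.elim (c x) Subtype.val
  obtain ⟨N₀, hN₀, hN₀U, hN₀δ, hind⟩ := hloc _ hU (Option (A x)) b (by
    rw [mk_option]
    exact add_le_of_le K.aleph0_le_LS (hA x).le (one_le_aleph0.trans K.aleph0_le_LS))
  choose t ht using fun y : N₀ => (hmem y).1 (hN₀U y.2)
  -- As `δ` is regular, a base of size below `δ` already lies in some `F i`; the next line takes a
  -- later index `j`, and `F j` contains the model on which `A x` depends over `F i`.
  obtain ⟨i, hi⟩ := exists_forall_lt_of_isRegular hδ hN₀δ t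
  obtain ⟨j, hj⟩ := exists_forall_lt_of_isRegular hδ (J := PUnit)
    (by simpa using one_lt_aleph0.trans_le hδ.1) (fun _ => i)
  have hN₀i : N₀ ≤ (F i).1 := fun y hy => hmono (hi ⟨y, hy⟩).le (ht ⟨y, hy⟩)
  have hb : #(Set.range b) < #C := by
    refine mk_range_le.trans_lt ?_
    rw [mk_option]
    exact add_lt_of_lt hC.inaccessible.isRegular.1 (small (hAM x))
      (one_lt_aleph0.trans_le hC.inaccessible.isRegular.1)
  refine hnx2 (F i) x (hx i) (hD.monotonicity _ _ _ _ _ (F i).2.1 hb hU.2 ?_ ?_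
    (hD.baseMonotonicity _ _ _ _ hN₀ (F i).2.1 hb hU.2 hN₀i ?_ hind))
  · exact fun a ha => ⟨some ⟨a, ha⟩, rfl⟩
  · exact (hF i j (hj PUnit.unit)).trans (le_iSup (fun i => (F i).1) j)
  · exact le_iSup (fun i => (F i).1) i

end Amalgamation

/-! ### Strong limits of prescribed cofinality. -/

section CardinalArithmetic

theorem beth_lt_of_isInaccessible {c : Cardinal.{w}} (hc : c.IsInaccessible) {d : Cardinal.{w}}
    (hd : d < c) : ℶ_ d.ord < c := by
  rw [← hc.beth_ord, beth_lt_beth]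
  exact ord_lt_ord.2 hd

theorem cof_beth_ord {c : Cardinal.{w}} (hc : c.IsRegular) : (ℶ_ c.ord).ord.cof = c := by
  have := Ordinal.cof_map_of_isNormal (isNormal_ord.comp isNormal_beth) (isSuccLimit_ord hc.1)
  exact this.trans hc.cof_ord

theorem isStrongLimit_beth_ord {c : Cardinal.{w}} (hc : c.IsRegular) :
    (ℶ_ c.ord).IsStrongLimit :=
  isStrongLimit_beth.2 (isSuccLimit_ord hc.1).isSuccPrelimit

theorem mk_set_lt_cof_le {α : Type w} {κ δ : Cardinal.{w}} (hκ : κ.IsStrongLimit)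
    (hδ : δ ≤ κ.ord.cof) (hα : #α ≤ κ) : #{s : Set α // #s < δ} ≤ κ := by
  rw [← mk_out κ, le_def] at hα
  obtain ⟨j⟩ := hα
  have h := mk_subset_mk_lt_cof (α := κ.out) (by simpa using hκ.isStrongPrelimit)
  rw [mk_out] at h
  rw [← h]
  refine mk_le_of_injective (f := fun s => ⟨j '' s.1, mk_image_le.trans_lt (s.2.trans_le hδ)⟩) ?_
  intro s t hst
  exact Subtype.ext (j.injective.image_injective (congrArg Subtype.val hst))

/-- A function is determined by its graph, a subset of size below the cofinality of a set of size at
most `κ`. -/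
theorem power_le_of_lt_cof {κ c : Cardinal.{w}} (hκ : κ.IsStrongLimit) (hc : c < κ.ord.cof) :
    κ ^ c ≤ κ := by
  have h1 : #(c.out × κ.out) ≤ κ := by
    rw [mk_prod, lift_id, lift_id, mk_out, mk_out]
    exact mul_le_of_le hκ.aleph0_le (hc.le.trans (Ordinal.cof_ord_le κ)) le_rfl
  refine le_trans ?_ (mk_set_lt_cof_le hκ le_rfl h1)
  have h2 : κ ^ c = #(c.out → κ.out) := by simp
  rw [h2]
  refine mk_le_of_injective (f := fun f => ⟨Set.range fun x => (x, f x),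
    mk_range_le.trans_lt (by simpa using hc)⟩) ?_
  intro f g hfg
  ext x
  have h3 : (x, f x) ∈ Set.range fun x => (x, g x) := by
    have h4 : Set.range (fun x => (x, f x)) = Set.range fun x => (x, g x) :=
      congrArg Subtype.val hfg
    exact h4 ▸ ⟨x, rfl⟩
  obtain ⟨y, hy⟩ := h3
  obtain ⟨rfl, h4⟩ := Prod.mk.inj hy
  exact h4.symm

theorem mk_iUnion_le_of_lift {α : Type w} {ι : Type (w + 1)} {κ : Cardinal.{w}} (hκ : ℵ₀ ≤ κ)
    {f : ι → Set α} (hι : #ι ≤ lift.{w + 1} κ) (hf : ∀ i, #(f i) ≤ κ) : #(⋃ i, f i) ≤ κ := by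
  rw [← lift_le.{w + 1}]
  refine (mk_iUnion_le_lift f).trans ?_
  rw [lift_id'.{w, w+1}]
  refine mul_le_of_le (by simpa using hκ) hι (ciSup_le' fun i => lift_le.2 (hf i))

/-- Rank `S` injectively by ordinals below `ℶ_μ` and cut at `ℶ_i` for `i < μ`; these cuts are
cofinal because `ℶ` is continuous. -/
theorem exists_cover_of_mk_le_beth {S : Type w} {μ : Cardinal.{w}} (hμ : ℵ₀ ≤ μ)
    (hS : #S ≤ ℶ_ μ.ord) : ∃ P : Ordinal.{w} → Set S,
      (∀ i < μ.ord, #(P i) < ℶ_ μ.ord) ∧ ∀ p, ∃ i < μ.ord, p ∈ P i := by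
  have h1 : #S ≤ #(ℶ_ μ.ord).ord.ToType := by simpa using hS
  obtain ⟨r⟩ := (le_def _ _).1 h1
  let rank : S → Ordinal.{w} := fun p => (Ordinal.ToType.mk.symm (r p)).1
  have hrank : Function.Injective rank :=
    Subtype.val_injective.comp (Ordinal.ToType.mk.symm.injective.comp r.injective)
  refine ⟨fun i => {p | rank p < (ℶ_ i).ord}, fun i hi => ?_, fun p => ?_⟩
  · refine lt_of_le_of_lt ?_ (beth_lt_beth.2 hi)
    rw [← lift_le.{w + 1}]
    have h2 := lift_mk_le_lift_mk_of_injective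
      (f := fun p : {p | rank p < (ℶ_ i).ord} => (⟨rank p, p.2⟩ : Set.Iio (ℶ_ i).ord))
      fun p q hpq => by
        have h3 : rank p = rank q :=
          congrArg (fun z : Set.Iio (ℶ_ i).ord => z.1) hpq
        exact Subtype.ext (hrank h3)
    rwa [mk_Iio_ordinal, card_ord, lift_lift, lift_umax.{w, w + 1}] at h2
  · have h2 : rank p < (ℶ_ μ.ord).ord := (Ordinal.ToType.mk.symm (r p)).2
    exact ((isNormal_ord.comp isNormal_beth).lt_iff_exists_lt (isSuccLimit_ord hμ)).1 h2

end CardinalArithmetic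

/-! ### The diagonal branch. -/

section TreeProperty

variable {L : FirstOrder.Language.{w, w}} {K : AEC L} {C : Type w} [L.Structure C]
  {D : L.Substructure C → Set C → Set C → Prop}

theorem IsSimpleIndependence.exists_localCharacter (hD : K.IsSimpleIndependence D)
    (hC : K.IsMonster C) : ∃ δ : Cardinal.{w}, δ.IsRegular ∧ δ < #C ∧ K.LS < δ ∧
      ∀ N : L.Substructure C, K.SmallModel N → ∀ (I : Type w) [Nonempty I] (b : I → C),
        #I ≤ K.LS → ∃ N₀ : L.Substructure C, K.SmallModel N₀ ∧ N₀ ≤ N ∧ #N₀ < δ ∧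
          D N₀ (Set.range b) N := by
  obtain ⟨θ, lam, hθ, hlam, hloc⟩ := hD.uniformLocalCharacter
  have hω := hC.inaccessible.isRegular.1
  -- Inaccessibility bounds the local character cardinal: `LS(K) ^ θ ≤ 2 ^ (LS(K) · θ) < ‖C‖`.
  have hpow : K.LS ^ θ < #C := by
    refine (power_le_power_right (cantor K.LS).le).trans_lt ?_
    rw [← power_mul]
    exact hC.inaccessible.isStrongLimit.isStrongPrelimit (mul_lt_of_lt hω hC.LS_lt hθ)
  have hlt : lam + K.LS ^ θ + K.LS < #C :=
    add_lt_of_lt hω (add_lt_of_lt hω hlam hpow) hC.LS_lt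
  have hle : K.LS ≤ lam + K.LS ^ θ + K.LS := self_le_add_left _ _
  refine ⟨Order.succ (lam + K.LS ^ θ + K.LS), isRegular_succ (K.aleph0_le_LS.trans hle),
    hC.inaccessible.isSuccLimit.succ_lt hlt, Order.lt_succ_of_le hle, fun N hN I _ b hI => ?_⟩
  obtain ⟨N₀, h1, h2, h3, h4⟩ := hloc N hN I b (hI.trans_lt hC.LS_lt)
  refine ⟨N₀, h1, h2, Order.lt_succ_of_le (h3.trans ((add_le_add_right ?_ lam).trans
    (self_le_add_right _ _))), h4⟩
  refine powerlt_le.2 fun x hx => (power_le_power_right hI).trans ?_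
  exact power_le_power_left (aleph0_pos.trans_le K.aleph0_le_LS).ne' hx.le

theorem restr_succ_eq_snoc {Λ : Type*} {γ β : Ordinal.{w}} (ν : Set.Iio γ → Λ)
    (h : Order.succ β ≤ γ) : restr ν (Order.succ β) h =
      snoc (restr ν β ((Order.le_succ β).trans h)) (ν ⟨β, (Order.lt_succ β).trans_le h⟩) := by
  ext ⟨i, hi⟩
  unfold snoc restr
  rcases (Order.lt_succ_iff.1 (Set.mem_Iio.1 hi)).lt_or_eq with h' | rfl
  · simp [h']
  · simp

/-- A simple independence relation rules out the tree property. -/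
theorem IsSimpleIndependence.not_hasKTreeProperty (hD : K.IsSimpleIndependence D)
    (hC : K.IsMonster C) (k : ℕ) : ¬ K.HasKTreeProperty C k := by
  classical
  intro htree
  obtain ⟨δ, hδ, hδC, hLSδ, hloc⟩ := hD.exists_localCharacter hC
  set κ : Cardinal.{w} := ℶ_ δ.ord with hκ
  have hκC : κ < #C := beth_lt_of_isInaccessible hC.inaccessible hδC
  have hκs : κ.IsStrongLimit := isStrongLimit_beth_ord hδ
  have hδκ : δ ≤ κ := le_beth_ord δ
  set μ : Cardinal.{w} := Order.succ κ with hμ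
  have hμr : μ.IsRegular := isRegular_succ hκs.aleph0_le
  have hμC : μ < #C := hC.inaccessible.isSuccLimit.succ_lt hκC
  have hκμ : κ < μ := Order.lt_succ κ
  set Λ : Cardinal.{w} := ℶ_ μ.ord with hΛ
  have hΛC : Λ < #C := beth_lt_of_isInaccessible hC.inaccessible hμC
  have hΛs : Λ.IsStrongLimit := isStrongLimit_beth_ord hμr
  have hμΛ : μ ≤ Λ := le_beth_ord μ
  have hcofΛ : Λ.ord.cof = μ := cof_beth_ord hμr
  have hωΛ := hΛs.aleph0_le
  have hLSμ : K.LS ≤ μ := (hLSδ.le.trans hδκ).trans hκμ.le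
  have hLSΛ : K.LS ≤ Λ := hLSμ.trans hμΛ
  obtain ⟨a, B, hB, hbranch, hincon⟩ := htree μ Λ hLSμ hμC hLSΛ hΛC
  -- a model of size at most `Λ` containing all the parameters
  have hnodes : ∀ β < μ.ord, #(Set.Iio β → Set.Iio Λ.ord) ≤ lift.{w + 1} Λ := by
    intro β hβ
    have hβc : β.card < Λ.ord.cof := by
      rw [hcofΛ]
      exact lt_ord.1 hβ
    have := lift_le.{w + 1}.2 (power_le_of_lt_cof hΛs hβc)
    simpa [mk_Iio_ordinal] using this
  have hBall : #(⋃ β : Set.Iio μ.ord, ⋃ η, B β.1 η : Set C) ≤ Λ := by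
    refine mk_iUnion_le_of_lift hωΛ ?_ fun β => mk_iUnion_le_of_lift hωΛ (hnodes β.1 β.2)
      fun η => (hB β.1 β.2 η).le.trans hLSΛ
    simpa [mk_Iio_ordinal] using hμΛ
  obtain ⟨M, hM, hBM, hMcard⟩ := hC.exists_smallModel (hBall.trans_lt hΛC)
  have hMΛ : #M ≤ Λ := hMcard.trans (add_le_of_le hωΛ hBall hLSΛ)
  have hBM' : ∀ β < μ.ord, ∀ η, B β η ⊆ M := fun β hβ η =>
    (Set.subset_iUnion_of_subset ⟨β, hβ⟩ (Set.subset_iUnion (fun η => B β η) η)).trans hBM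
  choose c hc using hbranch
  -- the base of each branch
  have hbase : ∀ ν, ∃ N₀ : L.Substructure C, K.SmallModel N₀ ∧ N₀ ≤ M ∧ #N₀ < δ ∧
      D N₀ {c ν} M := by
    intro ν
    obtain ⟨N₀, h1, h2, h3, h4⟩ := hloc M hM PUnit (fun _ => c ν)
      (by simpa using one_le_aleph0.trans K.aleph0_le_LS)
    rw [Set.range_const] at h4
    exact ⟨N₀, h1, h2, h3, h4⟩
  choose N₀ hN₀ hN₀M hN₀δ hN₀D using hbase
  let S := {N : L.Substructure C // N ≤ M ∧ #N < δ}
  have hS : #S ≤ Λ := by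
    refine le_trans ?_ (mk_set_lt_cof_le hΛs (hδκ.trans (hκμ.le.trans hcofΛ.ge)) hMΛ)
    refine mk_le_of_injective (f := fun N : S => ⟨Subtype.val ⁻¹' (N.1 : Set C),
      (mk_preimage_of_injective _ _ Subtype.val_injective).trans_lt N.2.2⟩) ?_
    intro N N' h
    have h' : (Subtype.val ⁻¹' (N.1 : Set C) : Set M) = Subtype.val ⁻¹' (N'.1 : Set C) :=
      congrArg Subtype.val h
    refine Subtype.ext (SetLike.ext fun x => ?_)
    by_cases hx : x ∈ M
    · exact Set.ext_iff.1 h' ⟨x, hx⟩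
    · exact iff_of_false (fun h => hx (N.2.1 h)) fun h => hx (N'.2.1 h)
  obtain ⟨P, hP, hcover⟩ := exists_cover_of_mk_le_beth hμr.1 hS
  let e : Λ.ord.ToType ≃ Set.Iio Λ.ord := Ordinal.ToType.mk.symm.toEquiv
  -- few immediate successors of a node lie on branches with a given base
  let Bad : ∀ β : Ordinal.{w}, (Set.Iio β → Set.Iio Λ.ord) → S → Set Λ.ord.ToType :=
    fun β η p => {t | ∃ (ν : Set.Iio μ.ord → Set.Iio Λ.ord) (h : Order.succ β ≤ μ.ord),
      N₀ ν = p.1 ∧ restr ν (Order.succ β) h = snoc η (e t)}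
  have hlim : Order.IsSuccLimit μ.ord := isSuccLimit_ord hμr.1
  have hBad : ∀ β < μ.ord, ∀ η p, #(Bad β η p) ≤ κ := by
    intro β hβ η p
    rcases isEmpty_or_nonempty (Bad β η p) with hemp | ⟨⟨_, ν₀, -, hν₀, -⟩⟩
    · simp
    choose ν h1 hνp hν using fun t : Bad β η p => t.2
    have hsβ : Order.succ β < μ.ord := hlim.succ_lt hβ
    have hsm : K.SmallModel p.1 := hν₀ ▸ hN₀ ν₀
    refine hD.mk_le_of_inconsistent hC hδ hκs (cof_beth_ord hδ).ge (hLSδ.trans_le hδκ) hloc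
      hsm hM p.2.1 (p.2.2.trans_le hδκ) (c := fun t => c (ν t))
      (A := fun t => B (Order.succ β) (snoc η (e t))) (k := k)
      (fun t => hBM' _ hsβ _) (fun t => hB _ hsβ _) (fun t => hνp t ▸ hN₀D (ν t)) ?_
    rintro s hs ⟨d, hd⟩
    refine hincon β hβ η (s.map ⟨fun t : Bad β η p => e t, e.injective.comp Subtype.val_injective⟩)
      (by simpa using hs) ⟨d, fun x hx => ?_⟩
    obtain ⟨t, ht, rfl⟩ := Finset.mem_map.1 hx
    have h2 := hc (ν t) (Order.succ β) hsβ
    rw [hν t] at h2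
    exact hC.realizes_trans ((hB _ hsβ _).trans hC.LS_lt) (hd t ht) h2
  -- The forbidden successors number at most `#(P β) · κ < Λ`, so one of the `Λ` successors remains.
  have hpick : ∀ (β : Ordinal.{w}) (η : Set.Iio β → Set.Iio Λ.ord), ∃ t, β < μ.ord →
      ∀ p ∈ P β, t ∉ Bad β η p := by
    intro β η
    by_cases hβ : β < μ.ord
    · by_contra! h
      have huniv : (⋃ p : P β, Bad β η p) = Set.univ :=
        Set.eq_univ_of_forall fun t => by
          obtain ⟨-, p, hp, ht⟩ := h t
          exact Set.mem_iUnion.2 ⟨⟨p, hp⟩, ht⟩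
      have hlt : #(⋃ p : P β, Bad β η p) < Λ :=
        (mk_iUnion_le _).trans_lt (mul_lt_of_lt hωΛ (hP β hβ)
          ((ciSup_le' fun p : P β => hBad β hβ η p).trans_lt (hκμ.trans_le hμΛ)))
      rw [huniv, mk_univ, mk_toType, card_ord] at hlt
      exact hlt.false
    · have : Nonempty Λ.ord.ToType := by
        rw [← mk_ne_zero_iff, mk_toType, card_ord]
        exact hΛs.ne_zero
      exact ⟨Classical.arbitrary _, fun h => (hβ h).elim⟩
  choose pick hpick using hpick
  let G : Ordinal.{w} → Set.Iio Λ.ord :=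
    (wellFounded_lt (α := Ordinal.{w})).fix fun β f => e (pick β fun j => f j.1 j.2)
  have hG : ∀ β, G β = e (pick β fun j => G j) := fun β => WellFounded.fix_eq _ _ _
  let ν : Set.Iio μ.ord → Set.Iio Λ.ord := fun i => G i
  -- The base of the diagonal branch lies in some `P β`, yet at level `β` the branch left through a
  -- successor on no branch with such a base.
  obtain ⟨β, hβ, hp⟩ := hcover ⟨N₀ ν, hN₀M ν, hN₀δ ν⟩
  refine hpick β (fun j => G j) hβ _ hp ⟨ν, (hlim.succ_lt hβ).le, rfl, ?_⟩
  rw [restr_succ_eq_snoc, ← hG β]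
  rfl

end TreeProperty

end AEC

theorem mainTheorem2 {L : FirstOrder.Language.{w, w}} (K : AEC L)
    (C : Type w) [L.Structure C] (hC : K.IsMonster C)
    (D : L.Substructure C → Set C → Set C → Prop)
    (hD : K.IsSimpleIndependence D)
    (hW : K.WitnessProperty D Cardinal.aleph0 1) :
    ¬ K.HasTreeProperty C := by
  rintro ⟨k, hk⟩
  exact hD.not_hasKTreeProperty hC k hk
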